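/- **Theorem (stable binary classification of the layered basis pursuit, L-BP).** *Setting.* Let $N\ge 1$, $K\ge 1$, channel numbers $m_0,\dots,m_K$ ($m_0=1$ for a single-channel signal in $\mathbb R^N$) and lengths $n_1,\dots,n_{K+1}\ge 1$. Vectors in $\mathbb R^{Nm_i}$ are indexed by a cyclic position in $\mathbb Z/N$ and a channel. For $1\le i\le K$ let $D_i\in\mathbb R^{Nm_{i-1}\times Nm_i}$ be the convolutional dictionary whose atoms are all $N$ cyclic shifts of $m_i$ filters of spatial length $n_i$ over $m_{i-1}$ channels; its atoms are $\ell_2$-normalized, and $\mu(D_i)$ is the maximal $|d^Td'|$ over pairs of distinct atoms ($0$ if there are none). A *patch* of a vector in $\mathbb R^{Nm_i}$ ($0\le i\le K$) consists of all channels at $n_{i+1}$ consecutive cyclic positions, where $n_{K+1}\ge1$ is arbitrary. A *stripe* of a vector in $\mathbb R^{Nm_i}$ ($1\le i\le K$) consists of all channels at the positions within cyclic distance $n_i-1$ of a given one. Let $\|\cdot\|_{0,\infty}^{S}$ and $\|\cdot\|_{0,\infty}^{P}$ be the maximal number of nonzeros in a stripe, respectively a patch, and $\|\cdot\|_{2,\infty}^{P}$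 the maximal $\ell_2$ norm of a patch. An ML-CSC signal $X$ with representations $\Gamma_1,\dots,\Gamma_K$ and sparsity levels $\lambda_1,\dots,\lambda_K$ satisfies $\Gamma_0=X$, $\Gamma_{i-1}=D_i\Gamma_i$ and $\|\Gamma_i\|_{0,\infty}^S\le\lambda_i$ for $1\le i\le K$. Let a family $(X^j)$ of ML-CSC signals with representations $\Gamma_i^j$ (same dictionaries and sparsity levels) be given, and a linear classifier $f(\Gamma)=w^T\Gamma+\omega$ on $\mathbb R^{Nm_K}$. The label of $X^j$ is $y^j=1$ if $f(\Gamma_K^j)>0$ and $y^j=-1$ otherwise, and $\mathcal O_{\mathcal B}^*=\inf_j\, y^jf(\Gamma_K^j)$ (a minimum for finite data). *Claim.* Let $X$, with representations $\Gamma_1,\dots,\Gamma_K$, be one of these signals, let $Y=X+E$ with $\|E\|_{2,\infty}^P\le\epsilon_0$, let $\hat\Gamma_0=Y$, and let $$\hat\Gamma_i\in\arg\min_{\Gamma}\ \xi_i\|\Gamma\|_1+\tfrac12\|D_i\Gamma-\hat\Gamma_{i-1}\|_2^2,\qquad \xi_i>0,\quad 1\le i\le K .$$ Put $\epsilon_i=\epsilon_0\cdot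 7.5^i\prod_{j=1}^i\sqrt{\|\Gamma_j\|_{0,\infty}^P}$ for $0\le i\le K$. Assume a) $\|\Gamma_i\|_{0,\infty}^S\le\frac13\left(1+\frac1{\mu(D_i)}\right)$ for $1\le i\le K$ (no constraint if $\mu(D_i)=0$); b) $\xi_i=4\epsilon_{i-1}$ for $1\le i\le K$; c) $\mathcal O_{\mathcal B}^*>7.5\,\|w\|_2\sqrt{\|\Gamma_K\|_0}\;\epsilon_K$. Then $\operatorname{sign}(f(\hat\Gamma_K))=\operatorname{sign}(f(\Gamma_K))$. (No condition involves the contrast, i.e. the ratio between the smallest and the largest coefficients in absolute value.) -/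

import Mathlib

open scoped Matrix

namespace LBP

noncomputable section

/-- A feature map: a vector in `ℝ^{N m}`, with `N` cyclic spatial positions and `m` channels. -/
abbrev FeatureMap (N m : ℕ) : Type := ZMod N × Fin m → ℝ

/-- A dictionary mapping feature maps with `m'` channels to feature maps with `m` channels.
Its columns (atoms) are indexed by a position and a channel of the code. -/
abbrev Dict (N m m' : ℕ) : Type := Matrix (ZMod N × Fin m) (ZMod N × Fin m') ℝ

/-- The convolutional dictionary with local filters `d c'` (`c' : Fin m'`), each of spatial length
`n` and acting on `m` channels, that is, of `n * m` entries. The atom `(q, c')` is the filter `d c'`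
placed at the positions `q, q + 1, …, q + n - 1` (cyclically): every filter is
shifted to every spatial location, all `m` channels at a time. -/
def convDict {N m m' n : ℕ} (d : Fin m' → Fin n → Fin m → ℝ) : Dict N m m' :=
  fun p q => if h : (p.1 - q.1).val < n then d q.2 ⟨(p.1 - q.1).val, h⟩ p.2 else 0

/-- The columns of the dictionary are `ℓ²`-normalized. -/
def NormalizedAtoms {N m m' : ℕ} [NeZero N] (D : Dict N m m') : Prop :=
  ∀ q, ∑ p, D p q ^ 2 = 1

/-- Mutual coherence `μ(D) = max_{q ≠ q'} |⟨d_q, d_q'⟩|` (`0` if there are no two distinct atoms). -/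
def coherence {N m m' : ℕ} [NeZero N] (D : Dict N m m') : ℝ :=
  ⨆ a : {a : (ZMod N × Fin m') × (ZMod N × Fin m') // a.1 ≠ a.2},
    |∑ p, D p a.1.1 * D p a.1.2|

/-- Entries of the `t`-th patch of spatial length `n`: positions `t, …, t + n - 1` (cyclically),
all channels. -/
def patch {N m : ℕ} [NeZero N] (n : ℕ) (t : ZMod N) : Finset (ZMod N × Fin m) :=
  Finset.univ.filter fun q => (q.1 - t).val < n

/-- Entries of the `t`-th stripe for filters of spatial length `n`: positions
`t - (n - 1), …, t + (n - 1)` (cyclically), all channels. -/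
def stripe {N m : ℕ} [NeZero N] (n : ℕ) (t : ZMod N) : Finset (ZMod N × Fin m) :=
  Finset.univ.filter fun q => (q.1 - t).val < n ∨ (t - q.1).val < n

/-- `‖Γ‖₀`, the number of nonzero entries. -/
def l0 {N m : ℕ} [NeZero N] (G : FeatureMap N m) : ℕ :=
  (Finset.univ.filter fun q => G q ≠ 0).card

/-- `‖Γ‖_{0,∞}` over stripes: the maximal number of nonzero entries in a stripe. -/
def l0infStripe {N m : ℕ} [NeZero N] (n : ℕ) (G : FeatureMap N m) : ℕ :=
  Finset.univ.sup fun t : ZMod N => ((stripe n t).filter fun q => G q ≠ 0).card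

/-- `‖Γ‖_{0,∞}` over patches: the maximal number of nonzero entries in a patch. -/
def l0infPatch {N m : ℕ} [NeZero N] (n : ℕ) (G : FeatureMap N m) : ℕ :=
  Finset.univ.sup fun t : ZMod N => ((patch n t).filter fun q => G q ≠ 0).card

/-- `‖E‖_{2,∞}` over patches: the maximal `ℓ²` norm of a patch. -/
def l2infPatch {N m : ℕ} [NeZero N] (n : ℕ) (E : FeatureMap N m) : ℝ :=
  ⨆ t : ZMod N, √(∑ q ∈ patch n t, E q ^ 2)

/-- The `ℓ²` norm. -/
def l2 {N m : ℕ} [NeZero N] (v : FeatureMap N m) : ℝ := √(∑ q, v q ^ 2)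

/-- The `ℓ¹` norm. -/
def l1 {N m : ℕ} [NeZero N] (v : FeatureMap N m) : ℝ := ∑ q, |v q|

/-- The multi-layer convolutional sparse coding model with `K` layers, for a signal `X` with
representations `G 1, …, G K`. The dictionary of layer `i + 1`, with filters of spatial length `n i`,
is `D i`, and `G i = D i *ᵥ G (i + 1)` with `G 0 = X`. (Values with index beyond `K` play no
role.) -/
structure IsMLCSC {N : ℕ} [NeZero N] (K : ℕ) (m n : ℕ → ℕ) (D : ∀ i, Dict N (m i) (m (i + 1)))
    (lam : ℕ → ℝ) (X : FeatureMap N (m 0)) (G : ∀ i, FeatureMap N (m i)) : Prop where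
  signal : G 0 = X
  layer : ∀ i < K, G i = D i *ᵥ G (i + 1)
  sparse : ∀ i < K, (l0infStripe (n i) (G (i + 1)) : ℝ) ≤ lam (i + 1)

/-- The objective of Lagrangian basis pursuit, `ξ ‖Γ‖₁ + ½ ‖D Γ - Z‖₂²`. -/
def bpObjective {N m m' : ℕ} [NeZero N] (D : Dict N m m') (xi : ℝ) (Z : FeatureMap N m)
    (G : FeatureMap N m') : ℝ :=
  xi * l1 G + 1 / 2 * l2 (D *ᵥ G - Z) ^ 2

/-- `Gh 1, …, Gh K` is an output of layered basis pursuit on the input `Y`: each `Gh (i + 1)`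
minimizes the basis pursuit objective for the previous output `Gh i`, and `Gh 0 = Y`. -/
structure IsLayeredBP {N : ℕ} [NeZero N] (K : ℕ) (m : ℕ → ℕ) (D : ∀ i, Dict N (m i) (m (i + 1)))
    (xi : ℕ → ℝ) (Y : FeatureMap N (m 0)) (Gh : ∀ i, FeatureMap N (m i)) : Prop where
  input : Gh 0 = Y
  argmin : ∀ i < K, IsMinOn (bpObjective (D i) (xi (i + 1)) (Gh i)) Set.univ (Gh (i + 1))

/-- The error levels `ε_i = ε₀ · 7.5^i · ∏_{j=1}^i √‖Γ_j‖_{0,∞}` (over patches; the patches of `Γ_j`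
have spatial length `n j`). -/
def errLevel {N : ℕ} [NeZero N] (m n : ℕ → ℕ) (G : ∀ i, FeatureMap N (m i)) (eps0 : ℝ) (i : ℕ) : ℝ :=
  eps0 * 7.5 ^ i * ∏ j ∈ Finset.Icc 1 i, √(l0infPatch (n j) (G j) : ℝ)

/-- The linear discriminant function `f(Γ) = wᵀ Γ + ω`. -/
def discriminant {N m : ℕ} [NeZero N] (w : FeatureMap N m) (om : ℝ) (G : FeatureMap N m) : ℝ :=
  w ⬝ᵥ G + om

/-- The class of a signal whose deepest representation is `G`: `1` if `f(Γ) > 0`, else `-1`. -/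
def label {N m : ℕ} [NeZero N] (w : FeatureMap N m) (om : ℝ) (G : FeatureMap N m) : ℝ :=
  if 0 < discriminant w om G then 1 else -1

/-- The output margin (score) `y f(Γ)`. -/
def score {N m : ℕ} [NeZero N] (w : FeatureMap N m) (om : ℝ) (G : FeatureMap N m) : ℝ :=
  label w om G * discriminant w om G

/-- The universal margin: the least score over the data. (Scores are nonnegative, so the infimum
is a true one for every nonempty family.) -/
def margin {N m : ℕ} [NeZero N] {J : Type*} (w : FeatureMap N m) (om : ℝ)
    (G : J → FeatureMap N m) : ℝ :=
  ⨅ j, score w om (G j)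

end

end LBP

/-!
The proof propagates an error bound through the layers. Suppose the input of a layer is `D Γ + E`,
where every patch of `E` has `ℓ²` norm at most `ε`, and let `ξ = 4 ε`. Each atom is normalized and
supported in a patch, so `Dᵀ E` is at most `ε` in absolute value (`abs_transpose_mulVec_le`). Two
atoms overlap only within a stripe, so each row of the Gram matrix `Dᵀ D`, restricted to the support
of `Γ` and without its diagonal entry, has at most `‖Γ‖_{0,∞}` nonzero entries, each bounded by the
coherence `μ` (`abs_gram_mulVec_sub_le`). The sparsity assumption says `‖Γ‖_{0,∞} μ ≤ (1 + μ) / 3`,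
so the restricted Gram matrix is diagonally dominant.

A minimizer `x` of the objective among vectors supported in the support of `Γ` satisfies the
coordinatewise optimality conditions there, hence `|Dᵀ D (x - Γ)| ≤ ξ + ε = 5 ε` on the support, and
diagonal dominance gives `|x - Γ| ≤ 5 ε / (2 / 3 * (1 + μ))` (`abs_le_of_abs_gram_mulVec_le`). Off
the support the residual correlations are then at most `5 ε / 2 + ε < ξ`. By strict dual feasibility
every unrestricted minimizer vanishes there too (`eq_zero_of_isMinOn_of_dual_lt`), so the same
estimate applies to it: its support is contained in that of `Γ` and its error is at most
`7.5 ε` in each entry (`basisPursuit_stable`).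

Bounding the patch norm of this error by its sup norm and the patch sparsity yields the error level
of the next layer. At the deepest layer, the Cauchy–Schwarz inequality bounds the change of the
discriminant strictly below the margin.
-/

namespace LBP

variable {N m m' : ℕ} [NeZero N]

/-! ### The basis pursuit objective -/

lemma l2_sq (v : FeatureMap N m) : l2 v ^ 2 = ∑ q, v q ^ 2 :=
  Real.sq_sqrt (Finset.sum_nonneg fun _ _ => sq_nonneg _)

/-- Exact expansion of the objective around `x`: its smooth part is quadratic, with gradient
`Dᵀ (D x - Z)`. -/
lemma bpObjective_add (D : Dict N m m') (xi : ℝ) (Z : FeatureMap N m) (x h : FeatureMap N m') :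
    bpObjective D xi Z (x + h) = bpObjective D xi Z x +
      ∑ q, (xi * (|x q + h q| - |x q|) + h q * (Dᵀ *ᵥ (D *ᵥ x - Z)) q) +
      1 / 2 * ∑ p, (D *ᵥ h) p ^ 2 := by
  have hcross : ∑ q, h q * (Dᵀ *ᵥ (D *ᵥ x - Z)) q = ∑ p, (D *ᵥ x - Z) p * (D *ᵥ h) p := by
    change h ⬝ᵥ (Dᵀ *ᵥ (D *ᵥ x - Z)) = (D *ᵥ x - Z) ⬝ᵥ (D *ᵥ h)
    rw [Matrix.dotProduct_mulVec, Matrix.vecMul_transpose, dotProduct_comm]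
  have hsq : ∑ p, (D *ᵥ (x + h) - Z) p ^ 2 = ∑ p, (D *ᵥ x - Z) p ^ 2 +
      2 * ∑ p, (D *ᵥ x - Z) p * (D *ᵥ h) p + ∑ p, (D *ᵥ h) p ^ 2 := by
    rw [Finset.mul_sum, ← Finset.sum_add_distrib, ← Finset.sum_add_distrib]
    refine Finset.sum_congr rfl fun p _ => ?_
    simp only [Matrix.mulVec_add, Pi.sub_apply, Pi.add_apply]
    ring
  unfold bpObjective l1
  rw [l2_sq, l2_sq, hsq, Finset.sum_add_distrib, hcross, ← Finset.mul_sum,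
    Finset.sum_sub_distrib]
  simp only [Pi.add_apply]
  ring

lemma bpObjective_add_single {D : Dict N m m'} (hD : NormalizedAtoms D) (xi : ℝ)
    (Z : FeatureMap N m) (x : FeatureMap N m') (q : ZMod N × Fin m') (t : ℝ) :
    bpObjective D xi Z (x + Pi.single q t) = bpObjective D xi Z x +
      (xi * (|x q + t| - |x q|) + t * (Dᵀ *ᵥ (D *ᵥ x - Z)) q) + 1 / 2 * t ^ 2 := by
  rw [bpObjective_add]
  congr 2
  · rw [Finset.sum_eq_single q]
    · simp
    · intro b _ hb
      simp [Pi.single_eq_of_ne hb]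
    · simp
  · have : ∀ p, (D *ᵥ Pi.single q t) p ^ 2 = D p q ^ 2 * t ^ 2 := by
      intro p
      simp [Matrix.mulVec_single, mul_pow]
    simp only [this, ← Finset.sum_mul, hD q, one_mul]

lemma abs_le_of_subgradient {xi a g : ℝ}
    (h : ∀ t : ℝ, 0 ≤ xi * (|a + t| - |a|) + t * g) (hxi : 0 < xi) : |g| ≤ xi := by
  have h₁ := h 1
  have h₂ := h (-1)
  have e₁ : |a + 1| - |a| ≤ 1 := by
    have := abs_add_le a 1
    rw [abs_one] at this
    linarith
  have e₂ : |a + -1| - |a| ≤ 1 := by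
    have := abs_add_le a (-1)
    rw [abs_neg, abs_one] at this
    linarith
  rw [abs_le]
  constructor <;> nlinarith

/-- First-order optimality in one coordinate: if the function `t ↦ ξ |a + t| + t g + t² / 2` is
minimal at `0`, then so is its linearization `t ↦ ξ |a + t| + t g`. -/
lemma subgradient_of_forall_le {xi a g : ℝ} (hxi : 0 < xi)
    (h : ∀ t : ℝ, 0 ≤ xi * (|a + t| - |a|) + t * g + 1 / 2 * t ^ 2) (t : ℝ) :
    0 ≤ xi * (|a + t| - |a|) + t * g := by
  -- By convexity, `s` times the value at `t` dominates the value at `s t`, which is `O(s²)`.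
  have key : ∀ s : ℝ, 0 < s → s ≤ 1 → -(s * (t ^ 2 / 2)) ≤ xi * (|a + t| - |a|) + t * g := by
    intro s hs hs1
    have h₁ := h (s * t)
    have h₂ : |a + s * t| ≤ (1 - s) * |a| + s * |a + t| := by
      have := abs_add_le ((1 - s) * a) (s * (a + t))
      rw [abs_mul, abs_mul, abs_of_nonneg (sub_nonneg.2 hs1), abs_of_pos hs] at this
      rwa [show (1 - s) * a + s * (a + t) = a + s * t by ring] at this
    have h₃ : xi * (|a + s * t| - |a|) ≤ xi * (s * (|a + t| - |a|)) :=
      mul_le_mul_of_nonneg_left (by linarith) hxi.le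
    have h₄ : 0 ≤ s * (xi * (|a + t| - |a|) + t * g + s * (t ^ 2 / 2)) := by
      nlinarith
    have := nonneg_of_mul_nonneg_right h₄ hs
    linarith
  by_contra! hneg
  set c := xi * (|a + t| - |a|) + t * g
  have hpos : 0 < t ^ 2 - c := by nlinarith [sq_nonneg t]
  have hs : 0 < -c / (t ^ 2 - c) := div_pos (by linarith) hpos
  have hs1 : -c / (t ^ 2 - c) ≤ 1 := by
    rw [div_le_one hpos]
    nlinarith [sq_nonneg t]
  have h₁ := key _ hs hs1
  have h₂ : -c / (t ^ 2 - c) * t ^ 2 ≤ -c := by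
    rw [div_mul_eq_mul_div, div_le_iff₀ hpos]
    nlinarith
  nlinarith

/-- The objective restricted to vectors supported in `T` has a minimizer, by coercivity of the
`ℓ¹` penalty. -/
lemma exists_restricted_minimizer (D : Dict N m m') {xi : ℝ} (hxi : 0 < xi) (Z : FeatureMap N m)
    (T : Set (ZMod N × Fin m')) :
    ∃ x : FeatureMap N m', (∀ q ∉ T, x q = 0) ∧
      ∀ y : FeatureMap N m', (∀ q ∉ T, y q = 0) → bpObjective D xi Z x ≤ bpObjective D xi Z y := by
  set C := bpObjective D xi Z 0 with hC
  have hbound : ∀ y : FeatureMap N m', ∀ q, xi * |y q| ≤ bpObjective D xi Z y := by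
    intro y q
    have h₁ : |y q| ≤ l1 y :=
      Finset.single_le_sum (f := fun q => |y q|) (fun _ _ => abs_nonneg _) (Finset.mem_univ q)
    have h₂ := mul_le_mul_of_nonneg_left h₁ hxi.le
    unfold bpObjective
    nlinarith [sq_nonneg (l2 (D *ᵥ y - Z))]
  have hcont : Continuous (bpObjective D xi Z) := by
    unfold bpObjective l1 l2
    have : Continuous fun G : FeatureMap N m' => D *ᵥ G - Z :=
      (Continuous.matrix_mulVec continuous_const continuous_id).sub continuous_const
    fun_prop
  set B : Set (FeatureMap N m') :=
    (Set.univ.pi fun _ => Set.Icc (-(C / xi)) (C / xi)) ∩ ⋂ q ∈ Tᶜ, {y | y q = 0}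
  have hB : IsCompact B := by
    refine (isCompact_univ_pi fun _ => isCompact_Icc).inter_right ?_
    exact isClosed_biInter fun q _ => isClosed_eq (continuous_apply q) continuous_const
  have hCxi : ∀ y : FeatureMap N m', (∀ q ∉ T, y q = 0) → bpObjective D xi Z y ≤ C → y ∈ B := by
    intro y hy hyC
    refine ⟨fun q _ => ?_, by simpa using hy⟩
    rw [Set.mem_Icc, ← abs_le, le_div_iff₀ hxi]
    linarith [hbound y q]
  have h0 : (0 : FeatureMap N m') ∈ B := hCxi 0 (fun _ _ => rfl) le_rfl
  obtain ⟨x, hxB, hx⟩ := hB.exists_isMinOn ⟨0, h0⟩ hcont.continuousOn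
  refine ⟨x, by simpa using hxB.2, fun y hy => ?_⟩
  rcases le_total (bpObjective D xi Z y) C with hyC | hyC
  · exact hx (hCxi y hy hyC)
  · exact (hx h0).trans hyC

/-- Strict dual feasibility: if `x` is optimal in the coordinates of `T`, vanishes off `T`, and its
residual correlations off `T` are smaller than `ξ`, then every minimizer vanishes off `T`. -/
lemma eq_zero_of_isMinOn_of_dual_lt {D : Dict N m m'} {xi : ℝ} {Z : FeatureMap N m}
    {T : Set (ZMod N × Fin m')} {x y : FeatureMap N m'} (hx : ∀ q ∉ T, x q = 0)
    (hopt : ∀ q ∈ T, ∀ t : ℝ, 0 ≤ xi * (|x q + t| - |x q|) + t * (Dᵀ *ᵥ (D *ᵥ x - Z)) q)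
    (hdual : ∀ q ∉ T, |(Dᵀ *ᵥ (D *ᵥ x - Z)) q| < xi)
    (hy : IsMinOn (bpObjective D xi Z) Set.univ y) : ∀ q ∉ T, y q = 0 := by
  intro q hq
  have hexp := bpObjective_add D xi Z x (y - x)
  rw [add_sub_cancel] at hexp
  have hle : bpObjective D xi Z y ≤ bpObjective D xi Z x := hy (Set.mem_univ x)
  have hsq : 0 ≤ ∑ p, (D *ᵥ (y - x)) p ^ 2 := Finset.sum_nonneg fun _ _ => sq_nonneg _
  have hoff : ∀ r ∉ T, (xi - |(Dᵀ *ᵥ (D *ᵥ x - Z)) r|) * |y r| ≤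
      xi * (|x r + (y - x) r| - |x r|) + (y - x) r * (Dᵀ *ᵥ (D *ᵥ x - Z)) r := by
    intro r hr
    have := neg_abs_le (y r * (Dᵀ *ᵥ (D *ᵥ x - Z)) r)
    rw [abs_mul] at this
    simp only [Pi.sub_apply, hx r hr, sub_zero, zero_add, abs_zero]
    linarith
  have hterm : ∀ r ∈ Finset.univ, 0 ≤
      xi * (|x r + (y - x) r| - |x r|) + (y - x) r * (Dᵀ *ᵥ (D *ᵥ x - Z)) r := by
    intro r _
    by_cases hr : r ∈ T
    · exact hopt r hr _
    · exact (mul_nonneg (sub_nonneg.2 (hdual r hr).le) (abs_nonneg _)).trans (hoff r hr)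
  have h₁ := (hoff q hq).trans (Finset.single_le_sum hterm (Finset.mem_univ q))
  have h₂ : (xi - |(Dᵀ *ᵥ (D *ᵥ x - Z)) q|) * |y q| ≤ 0 := by linarith
  have h₃ := sub_pos.2 (hdual q hq)
  by_contra hne
  linarith [mul_pos h₃ (abs_pos.2 hne)]

/-! ### Correlations of convolutional atoms -/

lemma coherence_nonneg (D : Dict N m m') : 0 ≤ coherence D :=
  Real.iSup_nonneg fun _ => abs_nonneg _

lemma abs_gram_le_coherence (D : Dict N m m') {q q' : ZMod N × Fin m'} (h : q ≠ q') :
    |(Dᵀ * D) q q'| ≤ coherence D :=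
  le_ciSup (f := fun a : {a : (ZMod N × Fin m') × (ZMod N × Fin m') // a.1 ≠ a.2} =>
    |∑ p, D p a.1.1 * D p a.1.2|) (Set.finite_range _).bddAbove ⟨(q, q'), h⟩

lemma gram_self {D : Dict N m m'} (hD : NormalizedAtoms D) (q : ZMod N × Fin m') :
    (Dᵀ * D) q q = 1 := by
  rw [← hD q, Matrix.mul_apply]
  exact Finset.sum_congr rfl fun p _ => by rw [Matrix.transpose_apply, sq]

lemma val_sub_lt_or {n : ℕ} {p a b : ZMod N} (ha : (p - a).val < n) (hb : (p - b).val < n) :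
    (b - a).val < n ∨ (a - b).val < n := by
  rcases le_total (p - b).val (p - a).val with h | h
  · left
    have := ZMod.val_sub h
    rw [sub_sub_sub_cancel_left] at this
    omega
  · right
    have := ZMod.val_sub h
    rw [sub_sub_sub_cancel_left] at this
    omega

/-- Atoms whose positions are not within a common stripe have disjoint supports. -/
lemma gram_convDict_eq_zero {n : ℕ} (d : Fin m' → Fin n → Fin m → ℝ)
    {q q' : ZMod N × Fin m'} (h : q' ∉ stripe n q.1) :
    ((convDict d : Dict N m m')ᵀ * (convDict d : Dict N m m')) q q' = 0 := by
  rw [Matrix.mul_apply]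
  refine Finset.sum_eq_zero fun p _ => ?_
  simp only [Matrix.transpose_apply, convDict]
  by_cases h₁ : (p.1 - q.1).val < n
  · by_cases h₂ : (p.1 - q'.1).val < n
    · exact absurd (by simpa [stripe] using val_sub_lt_or h₁ h₂) h
    · rw [dif_neg h₂, mul_zero]
  · rw [dif_neg h₁, zero_mul]

lemma card_stripe_le (n : ℕ) (G : FeatureMap N m) (t : ZMod N) :
    ((stripe n t).filter fun q => G q ≠ 0).card ≤ l0infStripe n G :=
  Finset.le_sup (f := fun t : ZMod N => ((stripe n t).filter fun q => G q ≠ 0).card)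
    (Finset.mem_univ t)

lemma card_patch_le (n : ℕ) (G : FeatureMap N m) (t : ZMod N) :
    ((patch n t).filter fun q => G q ≠ 0).card ≤ l0infPatch n G :=
  Finset.le_sup (f := fun t : ZMod N => ((patch n t).filter fun q => G q ≠ 0).card)
    (Finset.mem_univ t)

lemma sqrt_sum_patch_le (n : ℕ) (E : FeatureMap N m) (t : ZMod N) :
    √(∑ q ∈ patch n t, E q ^ 2) ≤ l2infPatch n E :=
  le_ciSup (f := fun t : ZMod N => √(∑ q ∈ patch n t, E q ^ 2)) (Set.finite_range _).bddAbove t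

/-- A normalized convolutional atom sees only one patch of the noise. -/
lemma abs_transpose_mulVec_le {n : ℕ} (d : Fin m' → Fin n → Fin m → ℝ)
    (hD : NormalizedAtoms (convDict d : Dict N m m')) (E : FeatureMap N m)
    (q : ZMod N × Fin m') :
    |((convDict d)ᵀ *ᵥ E) q| ≤ l2infPatch n E := by
  refine le_trans ?_ (sqrt_sum_patch_le n E q.1)
  apply Real.abs_le_sqrt
  have hsum : ((convDict d)ᵀ *ᵥ E) q = ∑ p ∈ patch n q.1, convDict d p q * E p := by
    change ∑ p, convDict d p q * E p = _
    refine (Finset.sum_subset (Finset.subset_univ _) fun p _ hp => ?_).symm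
    rw [convDict, dif_neg (by simpa [patch] using hp), zero_mul]
  have hone : ∑ p ∈ patch n q.1, convDict d p q ^ 2 ≤ 1 := by
    rw [← hD q]
    exact Finset.sum_le_univ_sum_of_nonneg fun _ => sq_nonneg _
  rw [hsum]
  refine (Finset.sum_mul_sq_le_sq_mul_sq _ _ _).trans ?_
  exact mul_le_of_le_one_left (Finset.sum_nonneg fun _ _ => sq_nonneg _) hone

/-- The off-diagonal part of a row of the Gram matrix, acting on a vector supported in the support
of `G`, involves only the nonzeros of `G` in one stripe. -/
lemma abs_gram_mulVec_sub_le {n : ℕ} (d : Fin m' → Fin n → Fin m → ℝ)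
    (hD : NormalizedAtoms (convDict d : Dict N m m')) {G v : FeatureMap N m'} {M : ℝ}
    (hM : ∀ q, |v q| ≤ M) (hv : ∀ q, G q = 0 → v q = 0) (q : ZMod N × Fin m') :
    |((convDict d)ᵀ *ᵥ (convDict d *ᵥ v)) q - v q| ≤
      (((stripe n q.1).filter fun p => G p ≠ 0).erase q).card *
        (coherence (convDict d : Dict N m m') * M) := by
  set D : Dict N m m' := convDict d with hDdef
  have hrow : (Dᵀ *ᵥ (D *ᵥ v)) q - v q =
      ∑ p ∈ ((stripe n q.1).filter fun p => G p ≠ 0).erase q, (Dᵀ * D) q p * v p := by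
    rw [Matrix.mulVec_mulVec]
    change ∑ p, (Dᵀ * D) q p * v p - v q = _
    rw [← Finset.add_sum_erase _ _ (Finset.mem_univ q), gram_self hD, one_mul, add_sub_cancel_left]
    refine (Finset.sum_subset (Finset.erase_subset_erase _ (Finset.subset_univ _))
      fun p hp hp' => ?_).symm
    have hpq : p ≠ q := (Finset.mem_erase.1 hp).1
    by_cases hs : p ∈ stripe n q.1
    · have hG : G p = 0 := by
        by_contra hne
        exact hp' (Finset.mem_erase.2 ⟨hpq, Finset.mem_filter.2 ⟨hs, hne⟩⟩)
      rw [hv p hG, mul_zero]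
    · rw [hDdef, gram_convDict_eq_zero d hs, zero_mul]
  rw [hrow, ← nsmul_eq_mul]
  refine (Finset.abs_sum_le_sum_abs _ _).trans (Finset.sum_le_card_nsmul _ _ _ fun p hp => ?_)
  rw [abs_mul]
  exact mul_le_mul (abs_gram_le_coherence D (Finset.mem_erase.1 hp).1.symm) (hM p) (abs_nonneg _)
    (coherence_nonneg D)

/-- Diagonal dominance of the Gram matrix on the support of `G`: a vector supported there is
controlled in sup norm by its image. -/
lemma abs_le_of_abs_gram_mulVec_le {n : ℕ} (hn : 1 ≤ n) (d : Fin m' → Fin n → Fin m → ℝ)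
    (hD : NormalizedAtoms (convDict d : Dict N m m')) {G v : FeatureMap N m'} {c : ℝ} (hc : 0 ≤ c)
    (hs : (l0infStripe n G : ℝ) * coherence (convDict d : Dict N m m') ≤
      1 / 3 * (1 + coherence (convDict d : Dict N m m')))
    (hv : ∀ q, G q = 0 → v q = 0)
    (hc' : ∀ q, G q ≠ 0 → |((convDict d)ᵀ *ᵥ (convDict d *ᵥ v)) q| ≤ c) (q : ZMod N × Fin m') :
    |v q| ≤ c / (2 / 3 * (1 + coherence (convDict d : Dict N m m'))) := by
  set mu := coherence (convDict d : Dict N m m')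
  have hmu : 0 ≤ mu := coherence_nonneg _
  have hpos : 0 < 2 / 3 * (1 + mu) := by positivity
  have : Nonempty (ZMod N × Fin m') := ⟨q⟩
  -- It suffices to treat a coordinate where `|v|` is largest.
  obtain ⟨r, hr⟩ := Finite.exists_max fun q => |v q|
  refine (hr q).trans ?_
  by_cases hG : G r = 0
  · rw [hv r hG, abs_zero]
    positivity
  have hrow := abs_gram_mulVec_sub_le d hD hr hv r
  have hmem : r ∈ (stripe n r.1).filter fun p => G p ≠ 0 := by
    simp [stripe, hG]
    omega
  have hcard : ((((stripe n r.1).filter fun p => G p ≠ 0).erase r).card : ℝ) + 1 ≤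
      l0infStripe n G := by
    have h₁ := Finset.card_erase_add_one hmem
    have h₂ := card_stripe_le n G r.1
    exact_mod_cast h₁.trans_le h₂
  have h₁ : ((((stripe n r.1).filter fun p => G p ≠ 0).erase r).card : ℝ) * (mu * |v r|) ≤
      ((l0infStripe n G : ℝ) - 1) * (mu * |v r|) :=
    mul_le_mul_of_nonneg_right (by linarith) (by positivity)
  have h₂ := mul_le_mul_of_nonneg_right hs (abs_nonneg (v r))
  have h₃ := abs_sub_abs_le_abs_sub (v r) (((convDict d)ᵀ *ᵥ (convDict d *ᵥ v)) r)
  rw [abs_sub_comm] at h₃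
  have h₄ := hc' r hG
  rw [le_div_iff₀ hpos]
  nlinarith

/-! ### Stability of one layer -/

/-- Stability of basis pursuit under locally bounded noise: the support of a minimizer is contained
in that of the true code, and its error is at most `7.5 ε` in each entry. -/
theorem basisPursuit_stable {n : ℕ} (hn : 1 ≤ n) (d : Fin m' → Fin n → Fin m → ℝ)
    (hD : NormalizedAtoms (convDict d : Dict N m m')) {G y : FeatureMap N m'} {Z : FeatureMap N m}
    {eps : ℝ} (heps : 0 < eps) (hZ : l2infPatch n (Z - convDict d *ᵥ G) ≤ eps)
    (hs : (l0infStripe n G : ℝ) * coherence (convDict d : Dict N m m') ≤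
      1 / 3 * (1 + coherence (convDict d : Dict N m m')))
    (hy : IsMinOn (bpObjective (convDict d) (4 * eps) Z) Set.univ y) :
    (∀ q, G q = 0 → y q = 0) ∧ ∀ q, |y q - G q| ≤ 7.5 * eps := by
  set D : Dict N m m' := convDict d with hDdef
  set mu := coherence D with hmudef
  have hmu : 0 ≤ mu := coherence_nonneg _
  have hxi : 0 < 4 * eps := by positivity
  have hnoise : ∀ q, |(Dᵀ *ᵥ (Z - D *ᵥ G)) q| ≤ eps := fun q =>
    (abs_transpose_mulVec_le d hD _ q).trans hZ
  have hsplit : ∀ (u : FeatureMap N m') q, (Dᵀ *ᵥ (D *ᵥ (u - G))) q =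
      (Dᵀ *ᵥ (D *ᵥ u - Z)) q + (Dᵀ *ᵥ (Z - D *ᵥ G)) q := by
    intro u q
    rw [← Pi.add_apply, ← Matrix.mulVec_add, sub_add_sub_cancel, Matrix.mulVec_sub]
  -- The sup norm estimate for any vector that is optimal on the support of `G`.
  have herr : ∀ u : FeatureMap N m', (∀ q, G q = 0 → u q = 0) →
      (∀ q, G q ≠ 0 → |(Dᵀ *ᵥ (D *ᵥ u - Z)) q| ≤ 4 * eps) →
      ∀ q, |(u - G) q| ≤ 5 * eps / (2 / 3 * (1 + mu)) := by
    intro u hu hopt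
    refine abs_le_of_abs_gram_mulVec_le hn d hD (by positivity) hs
      (fun q hq => by simp [hu q hq, hq]) fun q hq => ?_
    rw [← hDdef, hsplit]
    linarith [abs_add_le ((Dᵀ *ᵥ (D *ᵥ u - Z)) q) ((Dᵀ *ᵥ (Z - D *ᵥ G)) q), hopt q hq, hnoise q]
  obtain ⟨x, hx0, hx⟩ := exists_restricted_minimizer D hxi Z {q | G q ≠ 0}
  have hx0' : ∀ q, G q = 0 → x q = 0 := fun q hq => hx0 q (by simpa using hq)
  have hxopt : ∀ q ∈ {q | G q ≠ 0}, ∀ t : ℝ,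
      0 ≤ 4 * eps * (|x q + t| - |x q|) + t * (Dᵀ *ᵥ (D *ᵥ x - Z)) q := by
    intro q hq
    refine subgradient_of_forall_le hxi fun t => ?_
    have h := hx (x + Pi.single q t) fun r hr => by
      have hrq : r ≠ q := fun h => hr (h ▸ hq)
      simp [hx0 r hr, Pi.single_eq_of_ne hrq]
    rw [bpObjective_add_single hD] at h
    linarith
  have hxerr := herr x hx0' fun q hq => abs_le_of_subgradient (hxopt q hq) hxi
  have hxdual : ∀ q ∉ {q | G q ≠ 0}, |(Dᵀ *ᵥ (D *ᵥ x - Z)) q| < 4 * eps := by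
    intro q hq
    have hGq : G q = 0 := by simpa using hq
    have hrow := abs_gram_mulVec_sub_le (G := G) d hD hxerr (fun q hq => by simp [hx0' q hq, hq]) q
    have hM : 0 ≤ mu * (5 * eps / (2 / 3 * (1 + mu))) := by positivity
    have hcard : ((((stripe n q.1).filter fun p => G p ≠ 0).erase q).card : ℝ) ≤
        l0infStripe n G := by
      exact_mod_cast (Finset.card_erase_le).trans (card_stripe_le n G q.1)
    have h₁ := mul_le_mul_of_nonneg_right hcard hM
    have h₂ : (l0infStripe n G : ℝ) * (mu * (5 * eps / (2 / 3 * (1 + mu)))) ≤ 5 / 2 * eps := by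
      calc (l0infStripe n G : ℝ) * (mu * (5 * eps / (2 / 3 * (1 + mu))))
          = (l0infStripe n G * mu) * (5 * eps / (2 / 3 * (1 + mu))) := by ring
        _ ≤ (1 / 3 * (1 + mu)) * (5 * eps / (2 / 3 * (1 + mu))) :=
            mul_le_mul_of_nonneg_right hs (by positivity)
        _ = 5 / 2 * eps := by field_simp
    have h₃ : (x - G) q = 0 := by simp [hx0' q hGq, hGq]
    rw [← hDdef, ← hmudef, h₃, sub_zero, hsplit] at hrow
    have h₄ := abs_sub_abs_le_abs_sub ((Dᵀ *ᵥ (D *ᵥ x - Z)) q) (-(Dᵀ *ᵥ (Z - D *ᵥ G)) q)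
    rw [abs_neg, sub_neg_eq_add] at h₄
    linarith [hnoise q]
  have hy0 : ∀ q, G q = 0 → y q = 0 := fun q hq =>
    eq_zero_of_isMinOn_of_dual_lt hx0 hxopt hxdual hy q (by simpa using hq)
  refine ⟨hy0, fun q => (herr y hy0 (fun q _ => ?_) q).trans ?_⟩
  · refine abs_le_of_subgradient (subgradient_of_forall_le (a := y q) hxi fun t => ?_) hxi
    have h : bpObjective D (4 * eps) Z y ≤ bpObjective D (4 * eps) Z (y + Pi.single q t) :=
      hy (Set.mem_univ _)
    rw [bpObjective_add_single hD] at h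
    linarith
  · rw [div_le_iff₀ (by positivity)]
    nlinarith [mul_nonneg heps.le hmu]

/-! ### Propagation through the layers and classification -/

/-- The `ℓ²` norm on `S` of a vector supported in the support of `G`, in terms of its sup norm. -/
lemma sqrt_sum_sq_le {ι : Type*} {G v : ι → ℝ} {M : ℝ} (hM : 0 ≤ M)
    (hv : ∀ q, G q = 0 → v q = 0) (hvM : ∀ q, |v q| ≤ M) (S : Finset ι) :
    √(∑ q ∈ S, v q ^ 2) ≤ M * √((S.filter fun q => G q ≠ 0).card : ℝ) := by
  have h : ∑ q ∈ S, v q ^ 2 ≤ M ^ 2 * ((S.filter fun q => G q ≠ 0).card : ℝ) := by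
    rw [← Finset.sum_filter_of_ne (p := fun q => G q ≠ 0), mul_comm, ← nsmul_eq_mul]
    · exact Finset.sum_le_card_nsmul _ _ _ fun q _ => sq_le_sq.2 ((hvM q).trans (le_abs_self M))
    · intro q _ hq hG
      exact hq (by rw [hv q hG]; ring)
  refine (Real.sqrt_le_sqrt h).trans ?_
  rw [Real.sqrt_mul (sq_nonneg M), Real.sqrt_sq hM]

lemma errLevel_succ (m n : ℕ → ℕ) (G : ∀ i, FeatureMap N (m i)) (eps0 : ℝ) (i : ℕ) :
    errLevel m n G eps0 (i + 1) =
      7.5 * errLevel m n G eps0 i * √(l0infPatch (n (i + 1)) (G (i + 1)) : ℝ) := by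
  unfold errLevel
  rw [Finset.prod_Icc_succ_top (by omega), pow_succ]
  ring

lemma score_eq_abs (w : FeatureMap N m) (om : ℝ) (G : FeatureMap N m) :
    score w om G = |discriminant w om G| := by
  unfold score label
  split_ifs with h
  · rw [one_mul, abs_of_pos h]
  · rw [neg_one_mul, abs_of_nonpos (not_lt.1 h)]

lemma margin_le_abs {J : Type*} (w : FeatureMap N m) (om : ℝ) (G : J → FeatureMap N m) (j : J) :
    margin w om G ≤ |discriminant w om (G j)| := by
  rw [← score_eq_abs]
  refine ciInf_le ⟨0, ?_⟩ j
  rintro _ ⟨k, rfl⟩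
  simp only [score_eq_abs, abs_nonneg]

lemma one_le_l0infPatch {n : ℕ} (hn : 1 ≤ n) {G : FeatureMap N m} {q : ZMod N × Fin m}
    (hq : G q ≠ 0) : 1 ≤ l0infPatch n G := by
  refine le_trans (Finset.card_pos.2 ⟨q, ?_⟩) (card_patch_le n G q.1)
  simp [patch, hq]
  omega

lemma abs_dotProduct_le (w v : FeatureMap N m) : |w ⬝ᵥ v| ≤ l2 w * l2 v := by
  unfold l2
  rw [← Real.sqrt_mul (Finset.sum_nonneg fun _ _ => sq_nonneg _)]
  exact Real.abs_le_sqrt (Finset.sum_mul_sq_le_sq_mul_sq _ _ _)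

lemma sign_eq_of_abs_sub_lt {a b : ℝ} (h : |b - a| < |a|) : SignType.sign b = SignType.sign a := by
  rcases lt_trichotomy a 0 with ha | rfl | ha
  · rw [abs_of_neg ha] at h
    rw [sign_neg ha, sign_neg (by linarith [(abs_lt.1 h).2])]
  · rw [abs_zero] at h
    exact absurd h (not_lt.2 (abs_nonneg _))
  · rw [abs_of_pos ha] at h
    rw [sign_pos ha, sign_pos (by linarith [(abs_lt.1 h).1])]

end LBP

theorem mainTheorem2 {N : ℕ} [NeZero N] (K : ℕ) (hK : 1 ≤ K)
    -- channel numbers and filter (patch) lengths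
    (m n : ℕ → ℕ) (hn : ∀ i ≤ K, 1 ≤ n i)
    -- filters of the convolutional dictionaries, with normalized atoms
    (d : ∀ i, Fin (m (i + 1)) → Fin (n i) → Fin (m i) → ℝ)
    (D : ∀ i, LBP.Dict N (m i) (m (i + 1)))
    (hD : ∀ i < K, D i = LBP.convDict (d i))
    (hnorm : ∀ i < K, LBP.NormalizedAtoms (D i))
    -- the data and the classifier
    {J : Type*} (lam : ℕ → ℝ) (X : J → LBP.FeatureMap N (m 0))
    (G : J → ∀ i, LBP.FeatureMap N (m i))
    (hG : ∀ j, LBP.IsMLCSC K m n D lam (X j) (G j))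
    (w : LBP.FeatureMap N (m K)) (om : ℝ)
    -- one of the signals, contaminated by locally bounded noise
    (j : J) (E : LBP.FeatureMap N (m 0)) (eps0 : ℝ)
    (hE : LBP.l2infPatch (n 0) E ≤ eps0)
    -- layered basis pursuit with positive parameters
    (xi : ℕ → ℝ) (hxi_pos : ∀ i < K, 0 < xi (i + 1))
    (Gh : ∀ i, LBP.FeatureMap N (m i))
    (hGh : LBP.IsLayeredBP K m D xi (X j + E) Gh)
    (ha : ∀ i < K, 0 < LBP.coherence (D i) →
      (LBP.l0infStripe (n i) (G j (i + 1)) : ℝ) ≤ 1 / 3 * (1 + 1 / LBP.coherence (D i)))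
    (hb : ∀ i < K, xi (i + 1) = 4 * LBP.errLevel m n (G j) eps0 i)
    (hc : LBP.margin w om (fun j' => G j' K) >
      7.5 * LBP.l2 w * √(LBP.l0 (G j K) : ℝ) * LBP.errLevel m n (G j) eps0 K) :
    SignType.sign (LBP.discriminant w om (Gh K)) =
      SignType.sign (LBP.discriminant w om (G j K)) := by
  have hpos : ∀ i < K, 0 < LBP.errLevel m n (G j) eps0 i := fun i hi => by
    linarith [hb i hi, hxi_pos i hi]
  have hlayer : ∀ i < K, LBP.l2infPatch (n i) (Gh i - G j i) ≤ LBP.errLevel m n (G j) eps0 i →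
      (∀ q, G j (i + 1) q = 0 → Gh (i + 1) q = 0) ∧
      ∀ q, |Gh (i + 1) q - G j (i + 1) q| ≤ 7.5 * LBP.errLevel m n (G j) eps0 i := by
    intro i hi hpatch
    have hmin := hGh.argmin i hi
    have hnorm' := hnorm i hi
    have hsparse := ha i hi
    rw [(hG j).layer i hi] at hpatch
    rw [hb i hi] at hmin
    rw [hD i hi] at hmin hnorm' hsparse hpatch
    refine LBP.basisPursuit_stable (hn i hi.le) (d i) hnorm' (hpos i hi) hpatch ?_ hmin
    rcases (LBP.coherence_nonneg (LBP.convDict (d i) : LBP.Dict N _ _)).eq_or_lt with h0 | h0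
    · rw [← h0]
      norm_num
    · refine (mul_le_mul_of_nonneg_right (hsparse h0) h0.le).trans_eq ?_
      field_simp
      ring
  have hstep : ∀ i ≤ K, LBP.l2infPatch (n i) (Gh i - G j i) ≤ LBP.errLevel m n (G j) eps0 i := by
    intro i
    induction i with
    | zero =>
      intro _
      rw [hGh.input, (hG j).signal, add_sub_cancel_left]
      simpa [LBP.errLevel] using hE
    | succ i ih =>
      intro hi
      obtain ⟨hsupp, herr⟩ := hlayer i (by omega) (ih (by omega))
      have hM : 0 ≤ 7.5 * LBP.errLevel m n (G j) eps0 i :=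
        mul_nonneg (by norm_num) (hpos i (by omega)).le
      rw [LBP.errLevel_succ]
      refine ciSup_le fun t => ?_
      refine (LBP.sqrt_sum_sq_le (G := G j (i + 1)) hM
        (fun q hq => by simp [hsupp q hq, hq]) herr _).trans ?_
      exact mul_le_mul_of_nonneg_left
        (Real.sqrt_le_sqrt (Nat.cast_le.2 (LBP.card_patch_le _ _ _))) hM
  refine LBP.sign_eq_of_abs_sub_lt
    (lt_of_le_of_lt ?_ (hc.trans_le (LBP.margin_le_abs w om (fun j' => G j' K) j)))
  obtain ⟨k, rfl⟩ : ∃ k, K = k + 1 := ⟨K - 1, by omega⟩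
  obtain ⟨hsupp, herr⟩ := hlayer k (by omega) (hstep k (by omega))
  have hM : 0 ≤ 7.5 * LBP.errLevel m n (G j) eps0 k :=
    mul_nonneg (by norm_num) (hpos k (by omega)).le
  have hl2 : LBP.l2 (Gh (k + 1) - G j (k + 1)) ≤
      7.5 * LBP.errLevel m n (G j) eps0 k * √(LBP.l0 (G j (k + 1)) : ℝ) :=
    LBP.sqrt_sum_sq_le hM (fun q hq => by simp [hsupp q hq, hq]) herr Finset.univ
  -- The error level of the deepest layer dominates the sup norm of the error unless the deepest
  -- representation vanishes, in which case both sides are zero.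
  have hlevel : 7.5 * LBP.errLevel m n (G j) eps0 k * √(LBP.l0 (G j (k + 1)) : ℝ) ≤
      7.5 * (√(LBP.l0 (G j (k + 1)) : ℝ) * LBP.errLevel m n (G j) eps0 (k + 1)) := by
    by_cases hzero : ∀ q, G j (k + 1) q = 0
    · simp [LBP.l0, hzero]
    · push Not at hzero
      obtain ⟨q, hq⟩ := hzero
      have h₁ : (1 : ℝ) ≤ √(LBP.l0infPatch (n (k + 1)) (G j (k + 1)) : ℝ) := by
        rw [Real.one_le_sqrt]
        exact_mod_cast LBP.one_le_l0infPatch (hn (k + 1) le_rfl) hq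
      have h₂ : LBP.errLevel m n (G j) eps0 k ≤ LBP.errLevel m n (G j) eps0 (k + 1) := by
        rw [LBP.errLevel_succ]
        nlinarith [hpos k (by omega)]
      nlinarith [mul_le_mul_of_nonneg_right h₂ (Real.sqrt_nonneg (LBP.l0 (G j (k + 1)) : ℝ))]
  have hdiff : LBP.discriminant w om (Gh (k + 1)) - LBP.discriminant w om (G j (k + 1)) =
      w ⬝ᵥ (Gh (k + 1) - G j (k + 1)) := by
    rw [LBP.discriminant, LBP.discriminant, dotProduct_sub]
    ring
  rw [hdiff]
  calc |w ⬝ᵥ (Gh (k + 1) - G j (k + 1))| ≤ LBP.l2 w * LBP.l2 (Gh (k + 1) - G j (k + 1)) :=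
        LBP.abs_dotProduct_le _ _
    _ ≤ LBP.l2 w * (7.5 * (√(LBP.l0 (G j (k + 1)) : ℝ) * LBP.errLevel m n (G j) eps0 (k + 1))) :=
        mul_le_mul_of_nonneg_left (hl2.trans hlevel) (Real.sqrt_nonneg _)
    _ = _ := by ring
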